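/- Networks grow from a finite tree with at least two nodes by adding one node at a time; each new node attaches to exactly one existing node. For $\alpha\in\mathbb R$, the new node attaches to node $i$ with probability proportional to $$w_i^{\mathrm Q}(\alpha)=\frac{d_i^\alpha}{d_i+1}+\sum_{j\sim i}\frac{d_j^\alpha}{d_j+1}$$ in quantum preferential attachment (QPA), and proportional to $$w_i^{\mathrm{CR}}(\alpha,r)=(1-r)\,d_i^\alpha+r\sum_{j\sim i}d_j^{\alpha-1}$$ in the constant redirection model (CR), where $d_i$ is the degree of $i$. That is, an initial target is chosen with probability proportional to $d_i^\alpha$; the new node then attaches to a uniformly random member of the closed neighbourhood of the target (QPA), or to the target with probability $1-r$ and to a uniformly random neighbour of it with probability $r$ (CR). At $\alpha=-\infty$ the initial target is uniform among the nodes of minimum degree (the leaves). (a) On every finite tree with at least two nodes, the attachment probabilities of QPA and of CR with $r=1/2$ converge as $\alpha\to-\infty$ to those at $\alpha=-\infty$, and these are the same for the two models. Hence QPA at $\alpha=-\infty$ and CR at $\alpha=-\infty$, $r=1/2$ are the same process. (b) There is exactly one array $(q_{k,\ell})_{k,\ell\ge 0}$ of real numbers with $q_{0,1}=1/2$, $q_{1,1}=1/6$,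 $q_{k,0}=0$ for all $k\ge 0$, and $$(2k+1)\,q_{k,\ell}=(k-1)\,q_{k-1,\ell}+(k+1)\,q_{k+1,\ell-1}$$ for all $k,\ell\ge 0$ with $(k,\ell)\notin\{(0,1),(1,1)\}$, where a term with a negative index is zero. (c) Let a network grow by QPA at $\alpha=-\infty$ from an arbitrary finite tree with at least two nodes. Almost surely, for all $k,\ell\ge 0$, the fraction of nodes with exactly $k$ leaf neighbours and $\ell$ non-leaf neighbours converges to $q_{k,\ell}$ as the number of nodes tends to infinity; the expected fractions converge to $q_{k,\ell}$ as well. Almost surely, for all $x\ge 0$, the fraction of nodes of degree $x$ converges to $$p_x=\sum_{k+\ell=x}q_{k,\ell},$$ and $\sum_{x\ge0}p_x=1$. -/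

import Mathlib

open Filter Topology MeasureTheory

noncomputable section

/-- The network after a new node (the last element of `Fin (N + 1)`) attaches to the node `v`. -/
def addNode {N : ℕ} (G : SimpleGraph (Fin N)) (v : Fin N) : SimpleGraph (Fin (N + 1)) :=
  G.map Fin.castSuccEmb ⊔ SimpleGraph.edge v.castSucc (Fin.last N)

/-- The network after `n` arrivals, when it starts as `G₀` and the `i`-th arrival (`i = 0, 1, …`),
which is the node number `N₀ + i`, attaches to the node `v i`. -/
def network {N₀ : ℕ} (G₀ : SimpleGraph (Fin N₀)) (v : (i : ℕ) → Fin (N₀ + i)) :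
    (n : ℕ) → SimpleGraph (Fin (N₀ + n))
  | 0 => G₀
  | n + 1 => addNode (network G₀ v n) (v n)

open scoped Classical in
/-- Unnormalised probability that node `i` is the initial target: `d_i ^ α` for real `α`, and for
`α = -∞` (written `⊥`) the uniform choice among the nodes of minimum degree. -/
def targetWeight {N : ℕ} (α : WithBot ℝ) (G : SimpleGraph (Fin N)) (i : Fin N) : ℝ :=
  match α with
  | ⊥ => if G.degree i = G.minDegree then 1 else 0
  | (a : ℝ) => (G.degree i : ℝ) ^ a

open scoped Classical in
/-- Weight of a node in quantum preferential attachment: the new node attaches to a uniformly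
chosen member of the closed neighbourhood of the initial target. -/
def qpaWeight (α : WithBot ℝ) {N : ℕ} (G : SimpleGraph (Fin N)) (i : Fin N) : ℝ :=
  targetWeight α G i / ((G.degree i : ℝ) + 1)
    + ∑ j ∈ G.neighborFinset i, targetWeight α G j / ((G.degree j : ℝ) + 1)

open scoped Classical in
/-- Weight of a node in the constant redirection model: the new node attaches to the initial target
with probability `1 - r` and to a uniformly chosen neighbour of it with probability `r`. -/
def crWeight (α : WithBot ℝ) (r : ℝ) {N : ℕ} (G : SimpleGraph (Fin N)) (i : Fin N) : ℝ :=
  (1 - r) * targetWeight α G i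
    + r * ∑ j ∈ G.neighborFinset i, targetWeight α G j / (G.degree j : ℝ)

/-- Probability that the new node attaches to `i` in quantum preferential attachment. -/
def qpaProb (α : WithBot ℝ) {N : ℕ} (G : SimpleGraph (Fin N)) (i : Fin N) : ℝ :=
  qpaWeight α G i / ∑ j, qpaWeight α G j

/-- Probability that the new node attaches to `i` in the constant redirection model. -/
def crProb (α : WithBot ℝ) (r : ℝ) {N : ℕ} (G : SimpleGraph (Fin N)) (i : Fin N) : ℝ :=
  crWeight α r G i / ∑ j, crWeight α r G j

/-- The random attachment choices `V 0, V 1, …` follow the attachment rule `p` from the initial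
network `G₀`: given the choices before the `n`-th arrival, so that the current network is known, the
`n`-th arrival attaches to the node `x` with probability `p (current network) x`. -/
def FollowsRule {Ω : Type*} [MeasurableSpace Ω] (μ : Measure Ω)
    (p : {N : ℕ} → SimpleGraph (Fin N) → Fin N → ℝ)
    {N₀ : ℕ} (G₀ : SimpleGraph (Fin N₀)) (V : (i : ℕ) → Ω → Fin (N₀ + i)) : Prop :=
  (∀ i, Measurable (V i)) ∧
    ∀ (n : ℕ) (v : (i : ℕ) → Fin (N₀ + i)),
      μ.real {ω | (∀ i < n, V i ω = v i) ∧ V n ω = v n}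
        = μ.real {ω | ∀ i < n, V i ω = v i} * p (network G₀ v n) (v n)

/-- The choices `V` grow a quantum preferential attachment network with parameter `α`. -/
def IsQPA {Ω : Type*} [MeasurableSpace Ω] (μ : Measure Ω) (α : WithBot ℝ)
    {N₀ : ℕ} (G₀ : SimpleGraph (Fin N₀)) (V : (i : ℕ) → Ω → Fin (N₀ + i)) : Prop :=
  FollowsRule μ (qpaProb α) G₀ V

/-- The choices `V` grow a constant redirection network with parameters `α`, `r`. -/
def IsCR {Ω : Type*} [MeasurableSpace Ω] (μ : Measure Ω) (α : WithBot ℝ) (r : ℝ)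
    {N₀ : ℕ} (G₀ : SimpleGraph (Fin N₀)) (V : (i : ℕ) → Ω → Fin (N₀ + i)) : Prop :=
  FollowsRule μ (crProb α r) G₀ V

open scoped Classical in
/-- Number of leaf neighbours of a node. -/
def leafNeighbors {N : ℕ} (G : SimpleGraph (Fin N)) (i : Fin N) : ℕ :=
  ((G.neighborFinset i).filter fun j => G.degree j = 1).card

open scoped Classical in
/-- Number of non-leaf neighbours of a node. -/
def nonLeafNeighbors {N : ℕ} (G : SimpleGraph (Fin N)) (i : Fin N) : ℕ :=
  ((G.neighborFinset i).filter fun j => G.degree j ≠ 1).card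

/-- Fraction of nodes with `k` leaf neighbours and `l` non-leaf neighbours. -/
def stateFraction {N : ℕ} (G : SimpleGraph (Fin N)) (k l : ℕ) : ℝ :=
  ((Finset.univ.filter fun i => leafNeighbors G i = k ∧ nonLeafNeighbors G i = l).card : ℝ) / N

open scoped Classical in
/-- Fraction of nodes of degree `x`. -/
def degreeFraction {N : ℕ} (G : SimpleGraph (Fin N)) (x : ℕ) : ℝ :=
  ((Finset.univ.filter fun i => G.degree i = x).card : ℝ) / N

/-- The stationary recurrence `(2k+1) q_{k,l} = (k-1) q_{k-1,l} + (k+1) q_{k+1,l-1}`, where a term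
with a negative index is zero, with the initial values at `(0,1)` and `(1,1)` (which replace the
recurrence there) and the boundary values `q_{k,0} = 0`. -/
structure IsMasterSolution (q : ℕ → ℕ → ℝ) : Prop where
  init_zero_one : q 0 1 = 1 / 2
  init_one_one : q 1 1 = 1 / 6
  boundary : ∀ k, q k 0 = 0
  recurrence : ∀ k l : ℕ, (k, l) ≠ (0, 1) → (k, l) ≠ (1, 1) →
    (2 * (k : ℝ) + 1) * q k l
      = (if k = 0 then 0 else ((k : ℝ) - 1) * q (k - 1) l)
        + (if l = 0 then 0 else ((k : ℝ) + 1) * q (k + 1) (l - 1))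

end

/-! At `α = -∞` the target is a uniform leaf. Its closed neighbourhood has two nodes, so a uniform
choice there is the same as redirection with probability 1/2. Since `d ^ α` tends to 1 for `d = 1`
and to 0 for `d > 1`, this rule is also the limit as `α → -∞`. With L leaves, a node with k leaf
neighbours is chosen with probability ([it is a leaf] + k) / (2L).

Let Q(k,l) count the nodes in state (k,l). On a connected network with at least three nodes no two
leaves are adjacent, so every leaf is in state (0,1). A node gains a leaf neighbour, or sees one of
its leaf neighbours become a non-leaf, each at rate k / (2L). This gives the drift of Q(k,l) in
`drift_stateCount`. The drift of Q(0,1) = L is exactly 1/2, hence L/N → 1/2, and with 2L replaced by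
N the balance of the drift is the master recurrence.

Each count is its accumulated drift plus a martingale with bounded increments. Orthogonality of the
increments bounds the second moment linearly, so almost surely the martingale is o(n)
(`FollowsRule.ae_tendsto_noise`). On such a path the rest is deterministic:
`tendsto_div_of_recursion` carries limits from (k-1,l) and (k+1,l-1) to (k,l), and induction on l,
then k, reaches every state (`tendsto_stateFraction`). That the limits have total mass 1 follows by
summing the recurrence over degree classes, which telescopes
(`IsMasterSolution.hasSum_antidiagonal`). -/

/-! ### The master recurrence: existence, uniqueness, total mass. -/

/-- The row with index `l` of the solution of the master recurrence, given the previous row `r`. -/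
noncomputable def masterRow (r : ℕ → ℝ) (l : ℕ) : ℕ → ℝ
  | 0 => if l = 0 then 1 / 2 else r 1
  | k + 1 => ((k : ℝ) * masterRow r l k + ((k : ℝ) + 2) * r (k + 2)
      + if k = 0 ∧ l = 0 then 1 / 2 else 0) / (2 * (k : ℝ) + 3)

/-- The rows, indexed by the number of non-leaf neighbours, of the solution of the master
recurrence. -/
noncomputable def masterArray : ℕ → ℕ → ℝ
  | 0 => fun _ => 0
  | l + 1 => masterRow (masterArray l) l

/-- The inhomogeneous term that encodes the initial values of the master recurrence. -/
noncomputable def masterSource (k l : ℕ) : ℝ :=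
  if l = 1 ∧ (k = 0 ∨ k = 1) then 1 / 2 else 0

theorem isMasterSolution_masterArray : IsMasterSolution fun k l => masterArray l k where
  init_zero_one := by simp [masterArray, masterRow]
  init_one_one := by simp [masterArray, masterRow]; norm_num
  boundary k := rfl
  recurrence k l h0 h1 := by
    rcases l with _ | l
    · rcases k with _ | k <;> simp [masterArray]
    rcases k with _ | k
    · have hl : l ≠ 0 := by rintro rfl; exact h0 rfl
      simp [masterArray, masterRow, hl]
    · have hl : ¬ (k = 0 ∧ l = 0) := by rintro ⟨rfl, rfl⟩; exact h1 rfl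
      have h3 : (2 * (k : ℝ) + 3) ≠ 0 := by positivity
      simp only [masterArray, masterRow, hl, if_false, Nat.add_eq_zero_iff, one_ne_zero, and_false,
        Nat.add_sub_cancel]
      push_cast
      field_simp
      ring

namespace IsMasterSolution

variable {q : ℕ → ℕ → ℝ}

/-- The two initial values are what the recurrence yields once 1/2 is added to its right side at
(0,1) and (1,1), so the exceptional cases disappear. -/
theorem recurrence_source (hq : IsMasterSolution q) (k l : ℕ) :
    (2 * (k : ℝ) + 1) * q k l
      = (if k = 0 then 0 else ((k : ℝ) - 1) * q (k - 1) l)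
        + (if l = 0 then 0 else ((k : ℝ) + 1) * q (k + 1) (l - 1)) + masterSource k l := by
  by_cases h0 : (k, l) = (0, 1)
  · obtain ⟨rfl, rfl⟩ := Prod.mk.inj h0
    simp [hq.init_zero_one, hq.boundary, masterSource]
  by_cases h1 : (k, l) = (1, 1)
  · obtain ⟨rfl, rfl⟩ := Prod.mk.inj h1
    simp [hq.init_one_one, hq.boundary, masterSource]
    norm_num
  have : masterSource k l = 0 := by
    unfold masterSource
    rw [if_neg]
    rintro ⟨rfl, rfl | rfl⟩
    · exact h0 rfl
    · exact h1 rfl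
  rw [hq.recurrence k l h0 h1, this, add_zero]

/-- The right side uses only (k-1,l) and (k+1,l-1), so induction on l and then on k determines every
entry. -/
theorem unique {q' : ℕ → ℕ → ℝ} (hq : IsMasterSolution q) (hq' : IsMasterSolution q') :
    q' = q := by
  have key : ∀ l k, q' k l = q k l := by
    intro l
    induction l with
    | zero => intro k; rw [hq.boundary, hq'.boundary]
    | succ l ihl =>
      intro k
      have hk : (2 * (k : ℝ) + 1) ≠ 0 := by positivity
      refine mul_left_cancel₀ hk ?_
      rw [hq.recurrence_source, hq'.recurrence_source]
      induction k with
      | zero => simp [ihl]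
      | succ k ihk =>
        have h2 : (2 * (k : ℝ) + 1) ≠ 0 := by positivity
        have := ihk h2
        rw [← hq.recurrence_source, ← hq'.recurrence_source] at this
        simp [ihl, mul_left_cancel₀ h2 this]
  funext k l
  exact key l k

theorem nonneg (hq : IsMasterSolution q) (k l : ℕ) : 0 ≤ q k l := by
  have src : ∀ k l, 0 ≤ masterSource k l := fun k l => by unfold masterSource; split_ifs <;> norm_num
  induction l generalizing k with
  | zero => rw [hq.boundary]
  | succ l ihl =>
    induction k with
    | zero =>
      have := hq.recurrence_source 0 (l + 1)
      simp at this
      rw [this]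
      exact add_nonneg (ihl 1) (src _ _)
    | succ k ihk =>
      have h := hq.recurrence_source (k + 1) (l + 1)
      simp only [Nat.add_eq_zero_iff, one_ne_zero, and_false, if_false, Nat.add_sub_cancel] at h
      push_cast at h
      have h1 := src (k + 1) (l + 1)
      have h2 := mul_nonneg (Nat.cast_nonneg (α := ℝ) k) ihk
      have h3 : 0 ≤ ((k : ℝ) + 1 + 1) * q (k + 1 + 1) l := mul_nonneg (by positivity) (ihl _)
      have h4 : 0 ≤ (2 * ((k : ℝ) + 1) + 1) * q (k + 1) (l + 1) := by rw [h]; linarith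
      exact nonneg_of_mul_nonneg_right h4 (by positivity)

/-- The master recurrence summed over a degree class against a test function of the number of leaf
neighbours. -/
theorem sum_antidiagonal_succ (hq : IsMasterSolution q) (g : ℝ → ℝ) (x : ℕ) :
    ∑ kl ∈ Finset.HasAntidiagonal.antidiagonal (x + 1), g kl.1 * ((2 * (kl.1 : ℝ) + 1) * q kl.1 kl.2)
      = ∑ kl ∈ Finset.HasAntidiagonal.antidiagonal x, g (kl.1 + 1) * (kl.1 * q kl.1 kl.2)
        + ∑ kl ∈ Finset.HasAntidiagonal.antidiagonal (x + 1), g (kl.1 - 1) * (kl.1 * q kl.1 kl.2)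
        + ∑ kl ∈ Finset.HasAntidiagonal.antidiagonal (x + 1), g kl.1 * masterSource kl.1 kl.2 := by
  simp only [hq.recurrence_source, mul_add, Finset.sum_add_distrib]
  -- Going from (k-1,l) to (k,l) raises the degree by one, while going from (k+1,l-1) to (k,l) keeps
  -- it; hence only the first sum moves to degree `x`. The boundary terms vanish through the factor
  -- `kl.1`.
  congr 2
  · rw [Finset.Nat.sum_antidiagonal_succ]
    simp
  · rw [Finset.Nat.sum_antidiagonal_succ', Finset.Nat.sum_antidiagonal_succ]
    simp

/-- The two source states have degrees 1 and 2. -/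
theorem sum_antidiagonal_masterSource (g : ℝ → ℝ) (x : ℕ) :
    ∑ kl ∈ Finset.HasAntidiagonal.antidiagonal (x + 3), g kl.1 * masterSource kl.1 kl.2 = 0 := by
  refine Finset.sum_eq_zero fun kl hkl => ?_
  have := Finset.HasAntidiagonal.mem_antidiagonal.1 hkl
  rw [masterSource, if_neg (by omega), mul_zero]

/-- Let p, a, b be the sums of q, kq, k(k+1)q over a degree class. The test functions 1 and k give,
up to sources, p(x+1) = a(x) - a(x+1) and a(x+1) = b(x) - b(x+1). The second makes a summable, so a
→ 0; the first then telescopes to the two source terms 1/2 + 1/2. -/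
theorem hasSum_antidiagonal (hq : IsMasterSolution q) :
    HasSum (fun x : ℕ => ∑ kl ∈ Finset.HasAntidiagonal.antidiagonal x, q kl.1 kl.2) 1 := by
  set p : ℕ → ℝ := fun x => ∑ kl ∈ Finset.HasAntidiagonal.antidiagonal x, q kl.1 kl.2 with hp
  set a : ℕ → ℝ := fun x => ∑ kl ∈ Finset.HasAntidiagonal.antidiagonal x, kl.1 * q kl.1 kl.2 with ha
  set b : ℕ → ℝ := fun x =>
    ∑ kl ∈ Finset.HasAntidiagonal.antidiagonal x, (kl.1 * (kl.1 + 1)) * q kl.1 kl.2 with hb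
  have hp0 : ∀ x, 0 ≤ p x := fun x => Finset.sum_nonneg fun kl _ => hq.nonneg _ _
  have ha0 : ∀ x, 0 ≤ a x := fun x => Finset.sum_nonneg fun kl _ =>
    mul_nonneg (by positivity) (hq.nonneg _ _)
  have hb0 : ∀ x, 0 ≤ b x := fun x => Finset.sum_nonneg fun kl _ =>
    mul_nonneg (by positivity) (hq.nonneg _ _)
  have hpa : ∀ x, p (x + 1) = a x - a (x + 1)
      + ∑ kl ∈ Finset.HasAntidiagonal.antidiagonal (x + 1), 1 * masterSource kl.1 kl.2 := by
    intro x
    have h := hq.sum_antidiagonal_succ (fun _ => 1) x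
    have h2 : ∑ kl ∈ Finset.HasAntidiagonal.antidiagonal (x + 1),
          1 * ((2 * (kl.1 : ℝ) + 1) * q kl.1 kl.2)
        = 2 * a (x + 1) + p (x + 1) := by
      simp only [ha, hp, Finset.mul_sum, ← Finset.sum_add_distrib]
      exact Finset.sum_congr rfl fun _ _ => by ring
    simp only [one_mul] at h h2 ⊢
    rw [h2] at h
    simp only [ha] at h ⊢
    linarith
  have hab : ∀ x, a (x + 1) = b x - b (x + 1)
      + ∑ kl ∈ Finset.HasAntidiagonal.antidiagonal (x + 1), (kl.1 : ℝ) * masterSource kl.1 kl.2 := by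
    intro x
    have h := hq.sum_antidiagonal_succ (fun k => k) x
    have h1 : ∑ kl ∈ Finset.HasAntidiagonal.antidiagonal x,
        ((kl.1 : ℝ) + 1) * (kl.1 * q kl.1 kl.2) = b x :=
      Finset.sum_congr rfl fun _ _ => by ring
    have h2 : ∑ kl ∈ Finset.HasAntidiagonal.antidiagonal (x + 1),
          (kl.1 : ℝ) * ((2 * (kl.1 : ℝ) + 1) * q kl.1 kl.2)
        = ∑ kl ∈ Finset.HasAntidiagonal.antidiagonal (x + 1), ((kl.1 : ℝ) - 1) * (kl.1 * q kl.1 kl.2)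
          + b (x + 1) + a (x + 1) := by
      simp only [ha, hb, ← Finset.sum_add_distrib]
      exact Finset.sum_congr rfl fun _ _ => by ring
    rw [h1, h2] at h
    linarith
  have hsa : Summable a := by
    rw [← summable_nat_add_iff 3]
    refine summable_of_sum_range_le (c := b 2) (fun x => ha0 _) fun n => ?_
    have : ∀ n, ∑ i ∈ Finset.range n, a (i + 3) = b 2 - b (n + 2) := by
      intro n
      rw [← Finset.sum_range_sub' (fun i => b (i + 2))]
      refine Finset.sum_congr rfl fun i _ => ?_
      have := hab (i + 2)
      rw [sum_antidiagonal_masterSource (fun k => k) i] at this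
      simpa using this
    rw [this]
    linarith [hb0 (n + 2)]
  have hsum : ∀ n, ∑ x ∈ Finset.range (n + 3), p x = 1 - a (n + 2) := by
    intro n
    induction n with
    | zero =>
      have e1 := hpa 0
      have e2 := hpa 1
      have e3 : p 0 = 0 := by simp [hp, hq.boundary]
      have e4 : a 0 = 0 := by simp [ha]
      simp [Finset.Nat.antidiagonal_succ, masterSource] at e1 e2
      simp only [Finset.sum_range_succ, Finset.sum_range_zero, zero_add]
      linarith
    | succ n ih =>
      rw [Finset.sum_range_succ, ih, hpa, sum_antidiagonal_masterSource (fun _ => 1) n]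
      ring
  rw [hasSum_iff_tendsto_nat_of_nonneg hp0, ← tendsto_add_atTop_iff_nat 3]
  simp only [hsum]
  have := (tendsto_add_atTop_iff_nat 2).2 hsa.tendsto_atTop_zero
  simpa using this.const_sub 1

end IsMasterSolution

/-! ### Effect of one arrival on degrees and leaf neighbours. -/

section Graph

open scoped Classical

section AddNode

variable {N : ℕ} (G : SimpleGraph (Fin N)) (v : Fin N)

@[simp]
theorem addNode_adj_castSucc (a b : Fin N) :
    (addNode G v).Adj a.castSucc b.castSucc ↔ G.Adj a b := by
  have ha := (Fin.castSucc_lt_last a).ne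
  have hb := (Fin.castSucc_lt_last b).ne
  rw [addNode, SimpleGraph.sup_adj, SimpleGraph.edge_adj, SimpleGraph.map_adj]
  simp [ha, hb]

@[simp]
theorem addNode_adj_castSucc_last (a : Fin N) :
    (addNode G v).Adj a.castSucc (Fin.last N) ↔ a = v := by
  have ha := fun a : Fin N => (Fin.castSucc_lt_last a).ne
  rw [addNode, SimpleGraph.sup_adj, SimpleGraph.edge_adj, SimpleGraph.map_adj]
  simp [ha]

@[simp]
theorem addNode_adj_last_castSucc (a : Fin N) :
    (addNode G v).Adj (Fin.last N) a.castSucc ↔ a = v := by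
  rw [SimpleGraph.adj_comm, addNode_adj_castSucc_last]

variable {G v}

theorem degree_eq_sum (i : Fin N) : G.degree i = ∑ j, if G.Adj i j then 1 else 0 := by
  rw [← SimpleGraph.card_neighborFinset_eq_degree, SimpleGraph.neighborFinset_eq_filter,
    Finset.card_filter]

theorem leafNeighbors_eq_sum (i : Fin N) :
    leafNeighbors G i = ∑ j, if G.Adj i j ∧ G.degree j = 1 then 1 else 0 := by
  rw [leafNeighbors, SimpleGraph.neighborFinset_eq_filter, Finset.filter_filter,
    Finset.card_filter]

theorem leafNeighbors_add_nonLeafNeighbors (i : Fin N) :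
    leafNeighbors G i + nonLeafNeighbors G i = G.degree i := by
  rw [leafNeighbors, nonLeafNeighbors, Finset.card_filter_add_card_filter_not,
    SimpleGraph.card_neighborFinset_eq_degree]

theorem degree_addNode_castSucc (a : Fin N) :
    (addNode G v).degree a.castSucc = G.degree a + if a = v then 1 else 0 := by
  simp only [degree_eq_sum, Fin.sum_univ_castSucc, addNode_adj_castSucc, addNode_adj_castSucc_last]

theorem degree_addNode_last : (addNode G v).degree (Fin.last N) = 1 := by
  rw [degree_eq_sum, Fin.sum_univ_castSucc]
  simp only [addNode_adj_last_castSucc, SimpleGraph.irrefl, if_false]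
  simp

/-- The arrival is a new leaf at `v`, and `v` has degree at least 2 afterwards: if it was a leaf,
its neighbour loses it as a leaf neighbour. The loss stands on the left to avoid truncated
subtraction. -/
theorem leafNeighbors_addNode_castSucc (hv : 1 ≤ G.degree v) (a : Fin N) :
    leafNeighbors (addNode G v) a.castSucc + (if G.Adj v a ∧ G.degree v = 1 then 1 else 0)
      = leafNeighbors G a + if a = v then 1 else 0 := by
  simp only [leafNeighbors_eq_sum, Fin.sum_univ_castSucc, addNode_adj_castSucc,
    addNode_adj_castSucc_last, degree_addNode_castSucc, degree_addNode_last, and_true]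
  rw [add_right_comm]
  congr 1
  have : (if G.Adj v a ∧ G.degree v = 1 then 1 else 0)
      = ∑ j, if j = v then (if G.Adj j a ∧ G.degree j = 1 then 1 else 0) else 0 := by simp
  rw [this, ← Finset.sum_add_distrib]
  refine Finset.sum_congr rfl fun j _ => ?_
  rw [SimpleGraph.adj_comm G j a]
  by_cases hj : j = v
  · subst hj
    rw [if_pos rfl, if_pos rfl, if_neg (by omega), zero_add]
  · simp [hj]

theorem nonLeafNeighbors_addNode_castSucc (hv : 1 ≤ G.degree v) (a : Fin N) :
    nonLeafNeighbors (addNode G v) a.castSucc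
      = nonLeafNeighbors G a + (if G.Adj v a ∧ G.degree v = 1 then 1 else 0) := by
  have h1 := leafNeighbors_addNode_castSucc hv a
  have h2 := leafNeighbors_add_nonLeafNeighbors (G := G) a
  have h3 := leafNeighbors_add_nonLeafNeighbors (G := addNode G v) a.castSucc
  rw [degree_addNode_castSucc] at h3
  omega

theorem leafNeighbors_addNode_last (hv : 1 ≤ G.degree v) :
    leafNeighbors (addNode G v) (Fin.last N) = 0 := by
  rw [leafNeighbors_eq_sum, Fin.sum_univ_castSucc]
  simp only [addNode_adj_last_castSucc, degree_addNode_castSucc, SimpleGraph.irrefl, false_and,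
    if_false, add_zero]
  refine Finset.sum_eq_zero fun j _ => if_neg ?_
  rintro ⟨rfl, h⟩
  rw [if_pos rfl] at h
  omega

theorem nonLeafNeighbors_addNode_last (hv : 1 ≤ G.degree v) :
    nonLeafNeighbors (addNode G v) (Fin.last N) = 1 := by
  have h := leafNeighbors_add_nonLeafNeighbors (G := addNode G v) (Fin.last N)
  rwa [leafNeighbors_addNode_last hv, degree_addNode_last, zero_add] at h

end AddNode

/-! ### Leaves and the attachment rule at `α = -∞`. -/

/-- Every node has a neighbour, and some node is a leaf. -/
def HasLeaf {N : ℕ} (G : SimpleGraph (Fin N)) : Prop :=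
  (∀ i, 1 ≤ G.degree i) ∧ ∃ i, G.degree i = 1

/-- No two leaves are adjacent. -/
def LeavesApart {N : ℕ} (G : SimpleGraph (Fin N)) : Prop :=
  ∀ ⦃i j⦄, G.Adj i j → G.degree i = 1 → G.degree j ≠ 1

/-- The number of leaves. -/
noncomputable def leafCount {N : ℕ} (G : SimpleGraph (Fin N)) : ℝ :=
  ∑ i, if G.degree i = 1 then 1 else 0

/-- The sum over the nodes of a function of the numbers of leaf and non-leaf neighbours. -/
noncomputable def stateSum (F : ℕ → ℕ → ℝ) {N : ℕ} (G : SimpleGraph (Fin N)) : ℝ :=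
  ∑ i, F (leafNeighbors G i) (nonLeafNeighbors G i)

variable {N : ℕ} {G : SimpleGraph (Fin N)} {v : Fin N}

theorem HasLeaf.minDegree (h : HasLeaf G) : G.minDegree = 1 := by
  obtain ⟨h1, i, hi⟩ := h
  have : Nonempty (Fin N) := ⟨i⟩
  exact le_antisymm (hi ▸ G.minDegree_le_degree i) (G.le_minDegree_of_forall_le_degree 1 h1)

theorem SimpleGraph.IsTree.hasLeaf (hG : G.IsTree) (hN : 2 ≤ N) : HasLeaf G := by
  have : Nontrivial (Fin N) := Fin.nontrivial_iff_two_le.2 hN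
  have h := hG.minDegree_eq_one_of_nontrivial
  obtain ⟨i, hi⟩ := G.exists_minimal_degree_vertex
  exact ⟨fun j => h ▸ G.minDegree_le_degree j, i, by rw [← hi, h]⟩

theorem HasLeaf.addNode (h : HasLeaf G) (v : Fin N) : HasLeaf (addNode G v) := by
  refine ⟨fun i => ?_, Fin.last N, degree_addNode_last⟩
  induction i using Fin.lastCases with
  | last => rw [degree_addNode_last]
  | cast a => rw [degree_addNode_castSucc]; have := h.1 a; omega

/-- Two adjacent leaves form a connected component. -/
theorem SimpleGraph.Connected.leavesApart (hG : G.Connected) (hN : 3 ≤ N) : LeavesApart G := by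
  intro i j hij hi hj
  obtain ⟨z, hz⟩ : ∃ z, z ∉ ({i, j} : Finset (Fin N)) := by
    by_contra! hall
    have := Finset.card_le_card (fun z _ => hall z : (Finset.univ : Finset (Fin N)) ⊆ {i, j})
    have h2 := Finset.card_le_two (a := i) (b := j)
    rw [Finset.card_univ, Fintype.card_fin] at this
    omega
  obtain ⟨p⟩ := hG.preconnected i z
  -- A walk to a third node must leave `{i, j}` along some edge, but the only edge at either leaf is
  -- the one joining them.
  obtain ⟨d, -, hd1, hd2⟩ := p.exists_boundary_dart {i, j} (by simp) (by simpa using hz)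
  have hd := d.adj
  rw [SimpleGraph.degree_eq_one_iff_existsUnique_adj] at hi hj
  rcases hd1 with h | h
  · rw [h] at hd
    exact hd2 (Or.inr (hi.unique hd hij))
  · rw [Set.mem_singleton_iff] at h
    rw [h] at hd
    exact hd2 (Or.inl (hj.unique hd hij.symm))

theorem SimpleGraph.Connected.addNode (hG : G.Connected) (v : Fin N) :
    (addNode G v).Connected := by
  have key : ∀ i, (_root_.addNode G v).Reachable i v.castSucc := by
    intro i
    induction i using Fin.lastCases with
    | last => exact SimpleGraph.Adj.reachable (by simp)
    | cast a =>
      exact (hG.preconnected a v).map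
        (⟨Fin.castSucc, fun h => (addNode_adj_castSucc G v _ _).2 h⟩ :
          G →g _root_.addNode G v)
  exact (SimpleGraph.connected_iff _).2 ⟨fun i j => (key i).trans (key j).symm, ⟨v.castSucc⟩⟩

section Network

variable {N₀ : ℕ} {G₀ : SimpleGraph (Fin N₀)} (w : (i : ℕ) → Fin (N₀ + i))

theorem hasLeaf_network (h : HasLeaf G₀) (n : ℕ) : HasLeaf (network G₀ w n) := by
  induction n with
  | zero => exact h
  | succ n ih => exact ih.addNode (w n)

theorem connected_network (h : G₀.Connected) (n : ℕ) : (network G₀ w n).Connected := by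
  induction n with
  | zero => exact h
  | succ n ih => exact ih.addNode (w n)

theorem network_congr {w w' : (i : ℕ) → Fin (N₀ + i)} {n : ℕ} (h : ∀ i < n, w i = w' i) :
    network G₀ w n = network G₀ w' n := by
  induction n with
  | zero => rfl
  | succ n ih =>
    rw [network, network, ih fun i hi => h i (hi.trans n.lt_succ_self), h n n.lt_succ_self]

end Network

/-- Double counting of pairs of a leaf and a neighbour of it. With `f = 1` each leaf counts once,
having one neighbour. -/
theorem sum_leafNeighbors_mul (f : Fin N → ℝ) :
    ∑ i, (leafNeighbors G i : ℝ) * f i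
      = ∑ j, if G.degree j = 1 then ∑ i, (if G.Adj j i then f i else 0) else 0 := by
  simp only [leafNeighbors_eq_sum, Nat.cast_sum, Finset.sum_mul]
  rw [Finset.sum_comm]
  refine Finset.sum_congr rfl fun j _ => ?_
  split_ifs with h
  · exact Finset.sum_congr rfl fun i _ => by simp [h, SimpleGraph.adj_comm G i j]
  · exact Finset.sum_eq_zero fun i _ => by rw [if_neg fun h' => h h'.2, Nat.cast_zero, zero_mul]

theorem sum_leafNeighbors : ∑ i, (leafNeighbors G i : ℝ) = leafCount G := by
  have := sum_leafNeighbors_mul (G := G) fun _ => 1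
  simp only [mul_one] at this
  rw [this, leafCount]
  refine Finset.sum_congr rfl fun j _ => ?_
  split_ifs with h
  · have h2 := degree_eq_sum (G := G) j
    rw [h] at h2
    exact_mod_cast h2.symm
  · rfl

theorem HasLeaf.leafCount_pos (h : HasLeaf G) : 0 < leafCount G := by
  obtain ⟨-, i, hi⟩ := h
  refine Finset.sum_pos' (fun j _ => by split_ifs <;> norm_num) ⟨i, Finset.mem_univ i, ?_⟩
  simp [hi]

theorem HasLeaf.targetWeight_bot (h : HasLeaf G) (i : Fin N) :
    targetWeight ⊥ G i = if G.degree i = 1 then 1 else 0 := by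
  change (if G.degree i = G.minDegree then (1 : ℝ) else 0) = _
  rw [h.minDegree]

theorem HasLeaf.qpaWeight_bot (h : HasLeaf G) (i : Fin N) :
    qpaWeight ⊥ G i = ((if G.degree i = 1 then 1 else 0) + leafNeighbors G i) / 2 := by
  have h1 : ∀ j, targetWeight ⊥ G j / ((G.degree j : ℝ) + 1)
      = (if G.degree j = 1 then 1 else 0) / 2 := by
    intro j
    rw [h.targetWeight_bot]
    split_ifs with hj
    · rw [hj]; norm_num
    · simp
  rw [qpaWeight, h1, Finset.sum_congr rfl fun j _ => h1 j, ← Finset.sum_div, ← add_div,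
    leafNeighbors, Finset.card_filter]
  push_cast
  rfl

/-- Only leaves carry target weight; for them `1 / (d + 1) = 1/2` and `1 / d = 1`. -/
theorem HasLeaf.crWeight_bot (h : HasLeaf G) (i : Fin N) :
    crWeight ⊥ (1 / 2) G i = qpaWeight ⊥ G i := by
  have h1 : ∀ j, targetWeight ⊥ G j / (G.degree j : ℝ) = if G.degree j = 1 then 1 else 0 := by
    intro j
    rw [h.targetWeight_bot]
    split_ifs with hj
    · rw [hj]; norm_num
    · simp
  rw [crWeight, h.qpaWeight_bot, h.targetWeight_bot, Finset.sum_congr rfl fun j _ => h1 j,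
    leafNeighbors, Finset.card_filter]
  push_cast
  ring

theorem HasLeaf.crProb_bot (h : HasLeaf G) (i : Fin N) :
    crProb ⊥ (1 / 2) G i = qpaProb ⊥ G i := by
  simp only [crProb, qpaProb, h.crWeight_bot]

theorem HasLeaf.sum_qpaWeight_bot (h : HasLeaf G) : ∑ i, qpaWeight ⊥ G i = leafCount G := by
  simp only [h.qpaWeight_bot, ← Finset.sum_div, Finset.sum_add_distrib, sum_leafNeighbors]
  rw [← leafCount]
  ring

theorem HasLeaf.qpaProb_bot (h : HasLeaf G) (i : Fin N) :
    qpaProb ⊥ G i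
      = ((if G.degree i = 1 then 1 else 0) + leafNeighbors G i) / (2 * leafCount G) := by
  rw [qpaProb, h.sum_qpaWeight_bot, h.qpaWeight_bot, div_div]

theorem HasLeaf.sum_qpaProb_bot (h : HasLeaf G) : ∑ i, qpaProb ⊥ G i = 1 := by
  simp only [qpaProb, ← Finset.sum_div]
  rw [h.sum_qpaWeight_bot, div_self h.leafCount_pos.ne']

theorem HasLeaf.qpaProb_bot_nonneg (h : HasLeaf G) (i : Fin N) : 0 ≤ qpaProb ⊥ G i := by
  rw [h.qpaProb_bot]
  have := h.leafCount_pos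
  refine div_nonneg (add_nonneg ?_ (Nat.cast_nonneg _)) (by linarith)
  split_ifs <;> norm_num

theorem tendsto_targetWeight (h : HasLeaf G) (i : Fin N) :
    Tendsto (fun a : ℝ => targetWeight (a : WithBot ℝ) G i) atBot (𝓝 (targetWeight ⊥ G i)) := by
  rw [h.targetWeight_bot]
  have h1 := h.1 i
  change Tendsto (fun a : ℝ => (G.degree i : ℝ) ^ a) atBot _
  split_ifs with hi
  · simp [hi]
  · exact tendsto_rpow_atBot_of_base_gt_one _ (by exact_mod_cast (by omega : 1 < G.degree i))

theorem tendsto_qpaProb (h : HasLeaf G) (i : Fin N) :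
    Tendsto (fun a : ℝ => qpaProb (a : WithBot ℝ) G i) atBot (𝓝 (qpaProb ⊥ G i)) := by
  have hw : ∀ i, Tendsto (fun a : ℝ => qpaWeight (a : WithBot ℝ) G i) atBot
      (𝓝 (qpaWeight ⊥ G i)) := fun i =>
    ((tendsto_targetWeight h i).div_const _).add
      (tendsto_finsetSum _ fun j _ => (tendsto_targetWeight h j).div_const _)
  refine (hw i).div (tendsto_finsetSum _ fun j _ => hw j) ?_
  rw [h.sum_qpaWeight_bot]
  exact h.leafCount_pos.ne'

theorem tendsto_crProb (h : HasLeaf G) (i : Fin N) :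
    Tendsto (fun a : ℝ => crProb (a : WithBot ℝ) (1 / 2) G i) atBot
      (𝓝 (crProb ⊥ (1 / 2) G i)) := by
  have hw : ∀ i, Tendsto (fun a : ℝ => crWeight (a : WithBot ℝ) (1 / 2) G i) atBot
      (𝓝 (crWeight ⊥ (1 / 2) G i)) := fun i =>
    ((tendsto_targetWeight h i).const_mul _).add
      ((tendsto_finsetSum _ fun j _ => (tendsto_targetWeight h j).div_const _).const_mul _)
  refine (hw i).div (tendsto_finsetSum _ fun j _ => hw j) ?_
  simp only [h.crWeight_bot]
  rw [h.sum_qpaWeight_bot]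
  exact h.leafCount_pos.ne'

/-! ### One-step drift of state sums. -/

/-- An arrival at `v` creates a node in state `(0, 1)`, gives `v` one more leaf neighbour and, when
`v` was a leaf, turns a leaf neighbour of the neighbour of `v` into a non-leaf neighbour. -/
theorem stateSum_addNode (F : ℕ → ℕ → ℝ) (hv : 1 ≤ G.degree v) :
    stateSum F (addNode G v) - stateSum F G
      = F 0 1 + (F (leafNeighbors G v + 1) (nonLeafNeighbors G v)
          - F (leafNeighbors G v) (nonLeafNeighbors G v))
        + ∑ a, if G.Adj v a ∧ G.degree v = 1 then
            F (leafNeighbors G a - 1) (nonLeafNeighbors G a + 1)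
              - F (leafNeighbors G a) (nonLeafNeighbors G a) else 0 := by
  have h1 : F (leafNeighbors G v + 1) (nonLeafNeighbors G v)
      - F (leafNeighbors G v) (nonLeafNeighbors G v)
      = ∑ a, if a = v then F (leafNeighbors G a + 1) (nonLeafNeighbors G a)
          - F (leafNeighbors G a) (nonLeafNeighbors G a) else 0 := by simp
  rw [stateSum, Fin.sum_univ_castSucc, leafNeighbors_addNode_last hv,
    nonLeafNeighbors_addNode_last hv, h1, add_assoc, ← Finset.sum_add_distrib, stateSum,
    add_comm, add_sub_assoc, ← Finset.sum_sub_distrib]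
  congr 1
  refine Finset.sum_congr rfl fun a _ => ?_
  have hk := leafNeighbors_addNode_castSucc hv a
  rw [nonLeafNeighbors_addNode_castSucc hv a]
  by_cases ha : a = v
  · subst ha
    simp only [SimpleGraph.irrefl, false_and, if_false, add_zero, if_true] at hk ⊢
    rw [hk]
  · by_cases hb : G.Adj v a ∧ G.degree v = 1
    · simp only [ha, hb, and_self, if_true, if_false, add_zero, zero_add] at hk ⊢
      rw [← hk, Nat.add_sub_cancel]
    · simp only [ha, hb, if_false, add_zero] at hk ⊢
      rw [hk, sub_self]

/-- At most three terms change: the new node, `v`, and the neighbour of `v` when `v` was a leaf. -/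
theorem abs_stateSum_addNode_sub_le {F : ℕ → ℕ → ℝ} (hF0 : ∀ k l, 0 ≤ F k l)
    (hF1 : ∀ k l, F k l ≤ 1) (hv : 1 ≤ G.degree v) :
    |stateSum F (addNode G v) - stateSum F G| ≤ 3 := by
  have hd : ∀ a b c d, |F a b - F c d| ≤ 1 := fun a b c d => abs_sub_le_iff.2
    ⟨by linarith [hF1 a b, hF0 c d], by linarith [hF1 c d, hF0 a b]⟩
  have hs : |∑ a, if G.Adj v a ∧ G.degree v = 1 then
      F (leafNeighbors G a - 1) (nonLeafNeighbors G a + 1)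
        - F (leafNeighbors G a) (nonLeafNeighbors G a) else 0| ≤ 1 := by
    by_cases h1 : G.degree v = 1
    · calc _ ≤ ∑ a, if G.Adj v a then (1 : ℝ) else 0 := by
            refine (Finset.abs_sum_le_sum_abs _ _).trans (Finset.sum_le_sum fun a _ => ?_)
            by_cases ha : G.Adj v a
            · simpa [ha, h1] using hd _ _ _ _
            · simp [ha]
        _ = 1 := by
            have h2 := degree_eq_sum (G := G) v
            rw [h1] at h2
            exact_mod_cast h2.symm
    · simp [h1]
  rw [stateSum_addNode F hv]
  have h0 : |F 0 1| ≤ 1 := abs_le.2 ⟨by linarith [hF0 0 1], hF1 0 1⟩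
  refine (abs_add_le _ _).trans ?_
  refine (add_le_add (abs_add_le _ _) le_rfl).trans ?_
  linarith [hd (leafNeighbors G v + 1) (nonLeafNeighbors G v) (leafNeighbors G v)
    (nonLeafNeighbors G v)]

theorem LeavesApart.leafNeighbors_eq_zero (ha : LeavesApart G) (hv : G.degree v = 1) :
    leafNeighbors G v = 0 := by
  rw [leafNeighbors_eq_sum]
  exact Finset.sum_eq_zero fun j _ => if_neg fun h => ha h.1 hv h.2

theorem LeavesApart.nonLeafNeighbors_eq_one (ha : LeavesApart G) (hv : G.degree v = 1) :
    nonLeafNeighbors G v = 1 := by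
  have := leafNeighbors_add_nonLeafNeighbors (G := G) v
  rwa [ha.leafNeighbors_eq_zero hv, hv, zero_add] at this

/-- The expected change of the observable `S` at an arrival under the attachment rule `p`. -/
noncomputable def drift (p : {N : ℕ} → SimpleGraph (Fin N) → Fin N → ℝ)
    (S : {N : ℕ} → SimpleGraph (Fin N) → ℝ) {N : ℕ} (G : SimpleGraph (Fin N)) : ℝ :=
  ∑ x, p G x * (S (addNode G x) - S G)

/-- A chosen leaf passes from (0,1) to (1,1); this has probability 1/2 and, with the new node in
state (0,1), gives the constant terms. The loss of leaf status, summed over leaves and their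
neighbours, becomes a sum weighted by k through `sum_leafNeighbors_mul`. -/
theorem drift_stateSum (F : ℕ → ℕ → ℝ) (h : HasLeaf G) (ha : LeavesApart G) :
    drift (qpaProb ⊥) (stateSum F) G = F 0 1 / 2 + F 1 1 / 2
      + stateSum (fun k l => k * (F (k + 1) l + F (k - 1) (l + 1) - 2 * F k l)) G
        / (2 * leafCount G) := by
  have hL := h.leafCount_pos
  -- `U` is the change when a node gains a leaf neighbour, `D` the change when one of its leaf
  -- neighbours becomes a non-leaf.
  set U : Fin N → ℝ := fun v => F (leafNeighbors G v + 1) (nonLeafNeighbors G v)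
          - F (leafNeighbors G v) (nonLeafNeighbors G v) with hU
  set D : Fin N → ℝ := fun a => F (leafNeighbors G a - 1) (nonLeafNeighbors G a + 1)
              - F (leafNeighbors G a) (nonLeafNeighbors G a) with hD
  have e1 : ∑ x, ((if G.degree x = 1 then 1 else 0) + (leafNeighbors G x : ℝ)) * U x
      = leafCount G * (F 1 1 - F 0 1) + ∑ x, (leafNeighbors G x : ℝ) * U x := by
    simp only [add_mul, Finset.sum_add_distrib, leafCount, Finset.sum_mul]
    congr 1
    refine Finset.sum_congr rfl fun x _ => ?_
    split_ifs with hx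
    · simp [hU, ha.leafNeighbors_eq_zero hx, ha.nonLeafNeighbors_eq_one hx]
    · simp
  have e2 : ∑ x, ((if G.degree x = 1 then 1 else 0) + (leafNeighbors G x : ℝ))
      * (∑ a, if G.Adj x a ∧ G.degree x = 1 then D a else 0)
      = ∑ x, (leafNeighbors G x : ℝ) * D x := by
    rw [sum_leafNeighbors_mul]
    refine Finset.sum_congr rfl fun x _ => ?_
    split_ifs with hx
    · rw [ha.leafNeighbors_eq_zero hx, Nat.cast_zero, add_zero, one_mul]
      exact Finset.sum_congr rfl fun a _ => if_congr (and_iff_left hx) rfl rfl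
    · rw [Finset.sum_eq_zero fun a _ => if_neg fun h' => hx h'.2]
      simp
  have e3 : stateSum (fun k l => k * (F (k + 1) l + F (k - 1) (l + 1) - 2 * F k l)) G
      = ∑ x, (leafNeighbors G x : ℝ) * U x + ∑ x, (leafNeighbors G x : ℝ) * D x := by
    rw [stateSum, ← Finset.sum_add_distrib]
    exact Finset.sum_congr rfl fun x _ => by simp only [hU, hD]; ring
  have e4 : drift (qpaProb ⊥) (stateSum F) G
      = (∑ x, qpaProb ⊥ G x) * F 0 1
        + (∑ x, ((if G.degree x = 1 then 1 else 0) + (leafNeighbors G x : ℝ)) * U x)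
          / (2 * leafCount G)
        + (∑ x, ((if G.degree x = 1 then 1 else 0) + (leafNeighbors G x : ℝ))
          * (∑ a, if G.Adj x a ∧ G.degree x = 1 then D a else 0)) / (2 * leafCount G) := by
    rw [Finset.sum_mul, Finset.sum_div, Finset.sum_div, ← Finset.sum_add_distrib,
      ← Finset.sum_add_distrib]
    refine Finset.sum_congr rfl fun x _ => ?_
    change qpaProb ⊥ G x * _ = _
    rw [stateSum_addNode F (h.1 x), h.qpaProb_bot]
    simp only [hU, hD]
    ring
  rw [e4, h.sum_qpaProb_bot, e1, e2, e3]
  field_simp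
  ring

end Graph

/-! ### A strong law from linear second moments and bounded increments. -/

section PartialSums

theorem abs_sub_le_of_abs_succ_sub_le {a : ℕ → ℝ} {C : ℝ} (h : ∀ n, |a (n + 1) - a n| ≤ C)
    (m k : ℕ) : |a (m + k) - a m| ≤ C * k := by
  induction k with
  | zero => simp
  | succ k ih =>
    have h1 := abs_sub_le (a (m + (k + 1))) (a (m + k)) (a m)
    have h2 := h (m + k)
    rw [add_assoc] at h2
    push_cast
    linarith

/-- A sequence with bounded increments is sublinear when it is so along the squares. -/
theorem tendsto_div_of_tendsto_div_sq {a : ℕ → ℝ} {C : ℝ} (h : ∀ n, |a (n + 1) - a n| ≤ C)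
    (ha : Tendsto (fun m : ℕ => a (m ^ 2) / (m : ℝ) ^ 2) atTop (𝓝 0)) :
    Tendsto (fun n : ℕ => a n / n) atTop (𝓝 0) := by
  have hC : 0 ≤ C := (abs_nonneg _).trans (h 0)
  have hs : Tendsto Nat.sqrt atTop atTop := by
    refine tendsto_atTop.2 fun b => eventually_atTop.2 ⟨b * b, fun n hn => ?_⟩
    exact Nat.le_sqrt.2 hn
  have h1 : Tendsto (fun m : ℕ => |a (m ^ 2) / (m : ℝ) ^ 2| + 2 * C / m) atTop (𝓝 0) := by
    simpa using ha.abs.add (tendsto_const_div_atTop_nhds_zero_nat (2 * C))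
  refine squeeze_zero_norm' ?_ (h1.comp hs)
  filter_upwards [hs.eventually_ge_atTop 1, eventually_ge_atTop 1] with n hn hn1
  simp only [Function.comp]
  have hm1 : n.sqrt ^ 2 ≤ n := Nat.sqrt_le' n
  -- Consecutive squares leave a gap of at most `2m` after `m ^ 2`, over which `a` moves by at most
  -- `2Cm`, negligible against `m ^ 2`.
  have hm2 : n ≤ n.sqrt ^ 2 + 2 * n.sqrt := by
    have := Nat.sqrt_le_add n
    nlinarith
  generalize n.sqrt = m at *
  obtain ⟨k, rfl⟩ := Nat.exists_eq_add_of_le hm1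
  have hk : k ≤ 2 * m := by omega
  have hk' : (k : ℝ) ≤ 2 * m := by exact_mod_cast hk
  have hm0 : (0 : ℝ) < m := by exact_mod_cast hn
  have h2 := abs_sub_le_of_abs_succ_sub_le h (m ^ 2) k
  have h3 : |a (m ^ 2 + k)| ≤ |a (m ^ 2)| + C * (2 * m) := by
    have := abs_sub_abs_le_abs_sub (a (m ^ 2 + k)) (a (m ^ 2))
    have := mul_le_mul_of_nonneg_left hk' hC
    linarith
  have hd : (m : ℝ) ^ 2 ≤ ((m ^ 2 + k : ℕ) : ℝ) := by
    push_cast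
    linarith [Nat.cast_nonneg (α := ℝ) k]
  have hm4 : (0 : ℝ) < (m : ℝ) ^ 2 := by positivity
  rw [Real.norm_eq_abs, abs_div, abs_div, abs_of_pos hm4, Nat.abs_cast]
  calc |a (m ^ 2 + k)| / ((m ^ 2 + k : ℕ) : ℝ) ≤ (|a (m ^ 2)| + C * (2 * m)) / (m : ℝ) ^ 2 :=
        div_le_div₀ (by positivity) h3 hm4 hd
    _ = |a (m ^ 2)| / (m : ℝ) ^ 2 + 2 * C / m := by field_simp

end PartialSums

section StrongLaw

variable {Ω : Type*} [MeasurableSpace Ω] {μ : Measure Ω}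

/-- The series of the `f n` has finite expectation, hence converges almost surely, and its terms
tend to 0. -/
theorem ae_tendsto_zero_of_summable_integral {f : ℕ → Ω → ℝ} (hf : ∀ n ω, 0 ≤ f n ω)
    (hi : ∀ n, Integrable (f n) μ) (hs : Summable fun n => ∫ ω, f n ω ∂μ) :
    ∀ᵐ ω ∂μ, Tendsto (fun n => f n ω) atTop (𝓝 0) := by
  have hm : ∀ n, AEMeasurable (fun ω => ENNReal.ofReal (f n ω)) μ := fun n =>
    (hi n).1.aemeasurable.ennreal_ofReal
  have h1 : ∫⁻ ω, ∑' n, ENNReal.ofReal (f n ω) ∂μ ≠ ⊤ := by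
    rw [lintegral_tsum hm]
    have : ∀ n, ∫⁻ ω, ENNReal.ofReal (f n ω) ∂μ = ENNReal.ofReal (∫ ω, f n ω ∂μ) := fun n =>
      (ofReal_integral_eq_lintegral_ofReal (hi n) (Eventually.of_forall (hf n))).symm
    simp only [this]
    exact hs.tsum_ofReal_ne_top
  filter_upwards [ae_lt_top' (AEMeasurable.tsum hm) h1] with ω hω
  have h2 := ENNReal.tendsto_atTop_zero_of_tsum_ne_top hω.ne
  have h3 := (ENNReal.tendsto_toReal ENNReal.zero_ne_top).comp h2
  refine h3.congr fun n => ENNReal.toReal_ofReal (hf n ω)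

/-- Along squares the second moment of `M (m ^ 2) / m ^ 2` is at most `K / m ^ 2`, which is
summable; the bounded increments fill the gaps. -/
theorem ae_tendsto_div_of_integral_sq_le {M : ℕ → Ω → ℝ} {C K : ℝ}
    (hstep : ∀ n ω, |M (n + 1) ω - M n ω| ≤ C) (hi : ∀ n, Integrable (fun ω => M n ω ^ 2) μ)
    (h2 : ∀ n, ∫ ω, M n ω ^ 2 ∂μ ≤ K * n) :
    ∀ᵐ ω ∂μ, Tendsto (fun n : ℕ => M n ω / n) atTop (𝓝 0) := by
  have key : ∀ᵐ ω ∂μ, Tendsto (fun m : ℕ => (M (m ^ 2) ω / (m : ℝ) ^ 2) ^ 2) atTop (𝓝 0) := by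
    simp only [div_pow]
    refine ae_tendsto_zero_of_summable_integral (fun m ω => by positivity)
      (fun m => (hi _).div_const _) ?_
    refine Summable.of_nonneg_of_le (fun m => integral_nonneg fun ω => by positivity) (fun m => ?_)
      ((Real.summable_one_div_nat_pow.2 one_lt_two).mul_left K)
    rw [integral_div]
    rcases Nat.eq_zero_or_pos m with rfl | hm
    · simp
    · have hm0 : (0 : ℝ) < m := by exact_mod_cast hm
      rw [div_le_iff₀ (by positivity)]
      refine (h2 _).trans (le_of_eq ?_)
      push_cast
      field_simp
  filter_upwards [key] with ω hω
  refine tendsto_div_of_tendsto_div_sq (fun n => hstep n ω) ?_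
  have := (Real.continuous_sqrt.tendsto 0).comp hω
  rw [Real.sqrt_zero] at this
  rw [tendsto_zero_iff_abs_tendsto_zero]
  exact this.congr fun m => by simp [Real.sqrt_sq_eq_abs]

end StrongLaw

/-! ### Conditioning on the finite history of choices. -/

section History

variable {Ω : Type*} [MeasurableSpace Ω] {μ : Measure Ω} {N₀ : ℕ}
  {V : (i : ℕ) → Ω → Fin (N₀ + i)}

theorem DependsOn.measurable_comp {β : Type*} [MeasurableSpace β] [Nonempty β]
    (hV : ∀ i, Measurable (V i)) {n : ℕ} {f : ((i : ℕ) → Fin (N₀ + i)) → β}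
    (hf : DependsOn f (Set.Iio n)) : Measurable fun ω => f fun i => V i ω := by
  obtain ⟨g, rfl⟩ := dependsOn_iff_exists_comp.1 hf
  have hg : Measurable g := Measurable.of_discrete
  exact hg.comp (measurable_pi_lambda _ fun i => hV i)

/-- There are finitely many histories of length `n`, so such a function is bounded. -/
theorem DependsOn.integrable_comp [IsFiniteMeasure μ]
    (hV : ∀ i, Measurable (V i)) {n : ℕ} {f : ((i : ℕ) → Fin (N₀ + i)) → ℝ}
    (hf : DependsOn f (Set.Iio n)) : Integrable (fun ω => f fun i => V i ω) μ := by
  have hm := hf.measurable_comp hV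
  obtain ⟨g, rfl⟩ := dependsOn_iff_exists_comp.1 hf
  obtain ⟨C, hC⟩ := Finite.exists_le fun h => ‖g h‖
  exact Integrable.of_bound hm.aestronglyMeasurable C (Eventually.of_forall fun ω => hC _)

variable {p : {N : ℕ} → SimpleGraph (Fin N) → Fin N → ℝ} {G₀ : SimpleGraph (Fin N₀)}

open scoped Classical in
/-- Given the first `n` choices, the next one is `x` with the probability that the rule assigns. -/
theorem FollowsRule.integral_ite [IsFiniteMeasure μ] (h : FollowsRule μ p G₀ V) {n : ℕ}
    {g : ((i : ℕ) → Fin (N₀ + i)) → ℝ} (hg : DependsOn g (Set.Iio n)) (x : Fin (N₀ + n)) :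
    ∫ ω, (if V n ω = x then g (fun i => V i ω) else 0) ∂μ
      = ∫ ω, p (network G₀ (fun i => V i ω) n) x * g (fun i => V i ω) ∂μ := by
  obtain ⟨hV, hp⟩ := h
  set T : Ω → ((i : Set.Iio n) → Fin (N₀ + i)) := fun ω i => V i ω with hT
  have hTm : Measurable T := measurable_pi_lambda _ fun i => hV i
  have hms : ∀ t, MeasurableSet (T ⁻¹' {t}) := fun t => hTm (measurableSet_singleton t)
  have hx : MeasurableSet {ω | V n ω = x} := hV n (measurableSet_singleton x)
  have hd : Pairwise (Function.onFun Disjoint fun t => T ⁻¹' {t}) := fun s t hst =>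
    Disjoint.preimage T (by simpa using hst)
  have hu : ⋃ t, T ⁻¹' {t} = Set.univ := by ext; simp
  have i1 : Integrable (fun ω => if V n ω = x then g (fun i => V i ω) else 0) μ := by
    have : (fun ω => if V n ω = x then g (fun i => V i ω) else 0)
        = {ω | V n ω = x}.indicator fun ω => g (fun i => V i ω) := by
      ext ω; simp [Set.indicator]
    rw [this]
    exact (hg.integrable_comp hV).indicator hx
  have i2 : Integrable (fun ω => p (network G₀ (fun i => V i ω) n) x * g (fun i => V i ω)) μ :=
    DependsOn.integrable_comp (n := n) (f := fun w => p (network G₀ w n) x * g w) hV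
      fun w w' hw => by dsimp only; rw [network_congr hw, hg hw]
  rw [← setIntegral_univ, ← setIntegral_univ (f := fun ω => p _ x * _), ← hu,
    integral_iUnion_fintype hms hd fun t => i1.integrableOn,
    integral_iUnion_fintype hms hd fun t => i2.integrableOn]
  refine Finset.sum_congr rfl fun t _ => ?_
  rcases (T ⁻¹' {t}).eq_empty_or_nonempty with he | ⟨ω₀, hω₀⟩
  · simp [he]
  -- The rule is stated for full sequences: the sample point `ω₀` extends the history `t`, and
  -- position `n` is set to `x`.
  set v : (i : ℕ) → Fin (N₀ + i) := Function.update (fun i => V i ω₀) n x with hv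
  have hv1 : ∀ i < n, v i = V i ω₀ := fun i hi => Function.update_of_ne hi.ne _ _
  have hvn : v n = x := Function.update_self _ _ _
  have hset : T ⁻¹' {t} = {ω | ∀ i < n, V i ω = v i} := by
    ext ω
    rw [Set.mem_preimage, Set.mem_singleton_iff] at hω₀ ⊢
    rw [← hω₀, Set.mem_ofPred_eq]
    constructor
    · intro h i hi
      rw [hv1 i hi]
      exact congrFun h ⟨i, hi⟩
    · intro h
      funext ⟨i, hi⟩
      exact (h i hi).trans (hv1 i hi)
  have hmem : ∀ ω ∈ T ⁻¹' {t}, ∀ i < n, V i ω = v i := fun ω hω => by rwa [hset] at hω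
  have e1 : ∫ ω in T ⁻¹' {t}, (if V n ω = x then g (fun i => V i ω) else 0) ∂μ
      = ∫ ω in T ⁻¹' {t}, {ω | V n ω = x}.indicator (fun _ => g v) ω ∂μ := by
    refine setIntegral_congr_fun (hms t) fun ω hω => ?_
    simp only [Set.indicator, Set.mem_ofPred_eq]
    rw [hg (y := v) (hmem ω hω)]
  have e2 : ∫ ω in T ⁻¹' {t}, p (network G₀ (fun i => V i ω) n) x * g (fun i => V i ω) ∂μ
      = ∫ ω in T ⁻¹' {t}, p (network G₀ v n) x * g v ∂μ := by
    refine setIntegral_congr_fun (hms t) fun ω hω => ?_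
    rw [hg (y := v) (hmem ω hω), network_congr (hmem ω hω)]
  have e3 := hp n v
  rw [hvn, ← hset] at e3
  have e4 : {ω | (∀ i < n, V i ω = v i) ∧ V n ω = x} = T ⁻¹' {t} ∩ {ω | V n ω = x} := by
    rw [hset]; rfl
  rw [e4] at e3
  rw [e1, e2, setIntegral_indicator hx, setIntegral_const, setIntegral_const, e3, smul_eq_mul,
    smul_eq_mul, mul_assoc]

end History

/-! ### The martingale part of an observable. -/

section Noise

variable (p : {N : ℕ} → SimpleGraph (Fin N) → Fin N → ℝ)
  (S : {N : ℕ} → SimpleGraph (Fin N) → ℝ) {N₀ : ℕ} (G₀ : SimpleGraph (Fin N₀))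

/-- The deviation of the change of `S` at the `n`-th arrival from its conditional expectation. -/
noncomputable def noiseStep (n : ℕ) (w : (i : ℕ) → Fin (N₀ + i)) : ℝ :=
  S (network G₀ w (n + 1)) - S (network G₀ w n) - drift p S (network G₀ w n)

/-- The martingale part of the observable `S` along a growing network. -/
noncomputable def noise (n : ℕ) (w : (i : ℕ) → Fin (N₀ + i)) : ℝ :=
  ∑ i ∈ Finset.range n, noiseStep p S G₀ i w

variable {p S G₀}

theorem dependsOn_noiseStep (n : ℕ) : DependsOn (noiseStep p S G₀ n) (Set.Iio (n + 1)) :=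
  fun w w' h => by
    have h1 : network G₀ w (n + 1) = network G₀ w' (n + 1) := network_congr h
    have h2 : network G₀ w n = network G₀ w' n :=
      network_congr fun i hi => h i (hi.trans n.lt_succ_self)
    simp only [noiseStep, h1, h2]

theorem dependsOn_noise (n : ℕ) : DependsOn (noise p S G₀ n) (Set.Iio n) := fun _ _ h =>
  Finset.sum_congr rfl fun i hi => dependsOn_noiseStep i fun j hj =>
    h j (Set.mem_Iio.2 (lt_of_lt_of_le hj (Finset.mem_range.1 hi)))

theorem noise_succ (n : ℕ) (w : (i : ℕ) → Fin (N₀ + i)) :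
    noise p S G₀ (n + 1) w = noise p S G₀ n w + noiseStep p S G₀ n w :=
  Finset.sum_range_succ _ _

variable {Ω : Type*} [MeasurableSpace Ω] {μ : Measure Ω} {V : (i : ℕ) → Ω → Fin (N₀ + i)}

/-- Given the first `n` choices the noise is fixed, and the next step has mean 0 because `drift` is
the mean under `p`, which sums to 1. -/
theorem FollowsRule.integral_noise_mul_noiseStep [IsFiniteMeasure μ] (h : FollowsRule μ p G₀ V)
    (hp : ∀ (w : (i : ℕ) → Fin (N₀ + i)) n, ∑ x, p (network G₀ w n) x = 1) (n : ℕ) :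
    ∫ ω, noise p S G₀ n (fun i => V i ω) * noiseStep p S G₀ n (fun i => V i ω) ∂μ = 0 := by
  classical
  set g : Fin (N₀ + n) → ((i : ℕ) → Fin (N₀ + i)) → ℝ := fun x w =>
    noise p S G₀ n w * (S (addNode (network G₀ w n) x) - S (network G₀ w n)
      - drift p S (network G₀ w n)) with hg
  have hgd : ∀ x, DependsOn (g x) (Set.Iio n) := fun x w w' hw => by
    simp only [hg, network_congr hw, dependsOn_noise n hw]
  have e1 : ∀ w : (i : ℕ) → Fin (N₀ + i), noise p S G₀ n w * noiseStep p S G₀ n w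
      = ∑ x, if w n = x then g x w else 0 := by
    intro w
    simp [hg, noiseStep, network]
  have e2 : ∀ w : (i : ℕ) → Fin (N₀ + i), ∑ x, p (network G₀ w n) x * g x w = 0 := by
    intro w
    have : ∑ x, p (network G₀ w n) x * g x w
        = noise p S G₀ n w * (drift p S (network G₀ w n)
          - (∑ x, p (network G₀ w n) x) * drift p S (network G₀ w n)) := by
      conv_rhs => rw [drift]
      rw [Finset.sum_mul, ← Finset.sum_sub_distrib, Finset.mul_sum]
      refine Finset.sum_congr rfl fun x _ => ?_
      simp only [hg, drift]
      ring
    rw [this, hp, one_mul, sub_self, mul_zero]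
  have i1 : ∀ x, Integrable (fun ω => if V n ω = x then g x (fun i => V i ω) else 0) μ := fun x =>
    DependsOn.integrable_comp (n := n + 1) (f := fun w => if w n = x then g x w else 0) h.1
      fun w w' hw => by
        dsimp only
        rw [hw n n.lt_succ_self, hgd x fun i hi => hw i (Nat.lt_succ_of_lt hi)]
  have i2 : ∀ x, Integrable
      (fun ω => p (network G₀ (fun i => V i ω) n) x * g x (fun i => V i ω)) μ := fun x =>
    DependsOn.integrable_comp (n := n) (f := fun w => p (network G₀ w n) x * g x w) h.1
      fun w w' hw => by dsimp only; rw [network_congr hw, hgd x hw]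
  simp only [e1]
  rw [integral_finsetSum _ fun x _ => i1 x, Finset.sum_congr rfl fun x _ =>
    h.integral_ite (hgd x) x, ← integral_finsetSum _ fun x _ => i2 x]
  simp only [e2, integral_zero]

/-- With vanishing cross terms, each arrival adds at most `C ^ 2` to the second moment. -/
theorem FollowsRule.ae_tendsto_noise [IsProbabilityMeasure μ] (h : FollowsRule μ p G₀ V)
    (hp : ∀ (w : (i : ℕ) → Fin (N₀ + i)) n, ∑ x, p (network G₀ w n) x = 1) {C : ℝ}
    (hC : ∀ n w, |noiseStep p S G₀ n w| ≤ C) :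
    ∀ᵐ ω ∂μ, Tendsto (fun n : ℕ => noise p S G₀ n (fun i => V i ω) / n) atTop (𝓝 0) := by
  have hi : ∀ n, Integrable (fun ω => noise p S G₀ n (fun i => V i ω) ^ 2) μ := fun n =>
    DependsOn.integrable_comp (n := n) (f := fun w => noise p S G₀ n w ^ 2) h.1
      fun w w' hw => by dsimp only; rw [dependsOn_noise n hw]
  refine ae_tendsto_div_of_integral_sq_le (C := C) (K := C ^ 2)
    (fun n ω => by rw [noise_succ, add_sub_cancel_left]; exact hC _ _) hi fun n => ?_
  induction n with
  | zero => simp [noise]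
  | succ n ih =>
    have i1 : Integrable (fun ω => noiseStep p S G₀ n (fun i => V i ω) ^ 2) μ :=
      DependsOn.integrable_comp (n := n + 1) (f := fun w => noiseStep p S G₀ n w ^ 2) h.1
        fun w w' hw => by dsimp only; rw [dependsOn_noiseStep n hw]
    have i2 : Integrable (fun ω => noise p S G₀ n (fun i => V i ω)
        * noiseStep p S G₀ n (fun i => V i ω)) μ :=
      DependsOn.integrable_comp (n := n + 1)
        (f := fun w => noise p S G₀ n w * noiseStep p S G₀ n w) h.1
        fun w w' hw => by
          dsimp only
          rw [dependsOn_noiseStep n hw, dependsOn_noise n fun i hi => hw i (Nat.lt_succ_of_lt hi)]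
    have e : ∀ ω, noise p S G₀ (n + 1) (fun i => V i ω) ^ 2
        = noise p S G₀ n (fun i => V i ω) ^ 2
          + 2 * (noise p S G₀ n (fun i => V i ω) * noiseStep p S G₀ n (fun i => V i ω))
          + noiseStep p S G₀ n (fun i => V i ω) ^ 2 := fun ω => by rw [noise_succ]; ring
    have hle : ∫ ω, noiseStep p S G₀ n (fun i => V i ω) ^ 2 ∂μ ≤ C ^ 2 := by
      refine (integral_mono i1 (integrable_const (C ^ 2)) fun ω => ?_).trans (by simp)
      exact sq_le_sq' (abs_le.1 (hC _ _)).1 (abs_le.1 (hC _ _)).2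
    have e1 := integral_add ((hi n).add (i2.const_mul 2)) i1
    have e2 := integral_add (hi n) (i2.const_mul 2)
    rw [integral_const_mul, h.integral_noise_mul_noiseStep hp] at e2
    simp only [Pi.add_apply] at e1
    simp only [e]
    rw [e1, e2]
    push_cast
    linarith

end Noise

/-! ### Deterministic stochastic approximation. -/

/-- Convergence of a perturbed linear recursion of stochastic approximation type. -/
theorem tendsto_div_of_recursion {N₀ : ℕ} {c s : ℝ} (hc : 0 ≤ c) {X e M : ℕ → ℝ}
    (hM : Tendsto (fun n : ℕ => M n / n) atTop (𝓝 0)) (he : Tendsto e atTop (𝓝 0))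
    (hX : ∀ n ≥ 1, X (n + 1)
      = X n + (s - c * (X n / ((N₀ + n : ℕ) : ℝ)) + e n) + (M (n + 1) - M n)) :
    Tendsto (fun n : ℕ => X n / ((N₀ + n : ℕ) : ℝ)) atTop (𝓝 (s / (1 + c))) := by
  -- The slope of linear growth, from `q = s - c * q`.
  set q := s / (1 + c) with hq
  have hqs : s = q * (1 + c) := by rw [hq]; field_simp
  have hNinf : Tendsto (fun n : ℕ => ((N₀ + n : ℕ) : ℝ)) atTop atTop :=
    tendsto_natCast_atTop_atTop.comp (tendsto_atTop_mono (fun n => Nat.le_add_left n N₀) tendsto_id)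
  have hMN : Tendsto (fun n : ℕ => M n / ((N₀ + n : ℕ) : ℝ)) atTop (𝓝 0) := by
    refine squeeze_zero_norm' ?_ (tendsto_zero_iff_abs_tendsto_zero _ |>.1 hM)
    filter_upwards [eventually_ge_atTop 1] with n hn
    have hn0 : (0 : ℝ) < n := by exact_mod_cast hn
    simp only [Function.comp, Real.norm_eq_abs, abs_div, Nat.abs_cast]
    exact div_le_div_of_nonneg_left (abs_nonneg _) hn0
      (by push_cast; linarith [Nat.cast_nonneg (α := ℝ) N₀])
  set e' : ℕ → ℝ := fun n => |e n - c * (M n / ((N₀ + n : ℕ) : ℝ))| with he'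
  have he'0 : Tendsto e' atTop (𝓝 0) := by
    have := (he.sub (hMN.const_mul c)).abs
    simpa only [mul_zero, sub_zero, abs_zero] using this
  -- Removing the trend and `M` leaves a recursion with factor `1 - c / N`, eventually in [0,1], and
  -- an error that tends to 0. So `|W n| / n` is bounded by a vanishing term plus a Cesàro mean of
  -- the errors.
  set W : ℕ → ℝ := fun n => X n - q * ((N₀ + n : ℕ) : ℝ) - M n with hW
  obtain ⟨n₁, hn₁⟩ := eventually_atTop.1 (hNinf.eventually_ge_atTop (max c 1))
  set m := max n₁ 1 with hm
  have hstep : ∀ n ≥ m, |W (n + 1)| ≤ |W n| + e' n := by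
    intro n hn
    have hN := hn₁ n ((le_max_left _ _).trans hn)
    have hN1 : (1 : ℝ) ≤ ((N₀ + n : ℕ) : ℝ) := (le_max_right _ _).trans hN
    have hNc : c ≤ ((N₀ + n : ℕ) : ℝ) := (le_max_left _ _).trans hN
    have hN0 : (0 : ℝ) < ((N₀ + n : ℕ) : ℝ) := by linarith
    have hrec : W (n + 1) = W n * (1 - c / ((N₀ + n : ℕ) : ℝ))
        + (e n - c * (M n / ((N₀ + n : ℕ) : ℝ))) := by
      simp only [hW]
      rw [hX n ((le_max_right _ _).trans hn), hqs]
      have : ((N₀ + (n + 1) : ℕ) : ℝ) = ((N₀ + n : ℕ) : ℝ) + 1 := by push_cast; ring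
      rw [this]
      field_simp
      ring
    have hf0 : 0 ≤ 1 - c / ((N₀ + n : ℕ) : ℝ) := sub_nonneg.2 ((div_le_one hN0).2 hNc)
    have hf1 : 1 - c / ((N₀ + n : ℕ) : ℝ) ≤ 1 := sub_le_self _ (by positivity)
    rw [hrec]
    refine (abs_add_le _ _).trans (add_le_add ?_ le_rfl)
    rw [abs_mul, abs_of_nonneg hf0]
    exact mul_le_of_le_one_right (abs_nonneg _) hf1
  have hsum : ∀ n ≥ m, |W n| ≤ |W m| + ∑ i ∈ Finset.range n, e' i := by
    intro n hn
    induction n, hn using Nat.le_induction with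
    | base => exact le_add_of_nonneg_right (Finset.sum_nonneg fun i _ => abs_nonneg _)
    | succ n hn ih =>
      rw [Finset.sum_range_succ]
      linarith [hstep n hn]
  have hWN : Tendsto (fun n : ℕ => W n / ((N₀ + n : ℕ) : ℝ)) atTop (𝓝 0) := by
    have hb : Tendsto (fun n : ℕ => |W m| / n + (n : ℝ)⁻¹ * ∑ i ∈ Finset.range n, e' i) atTop
        (𝓝 0) := by
      simpa using (tendsto_const_div_atTop_nhds_zero_nat |W m|).add he'0.cesaro
    refine squeeze_zero_norm' ?_ hb
    filter_upwards [eventually_ge_atTop m] with n hn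
    have hn0 : (0 : ℝ) < n := by
      exact_mod_cast lt_of_lt_of_le one_pos ((le_max_right _ _).trans hn)
    rw [Real.norm_eq_abs, abs_div, Nat.abs_cast]
    calc |W n| / ((N₀ + n : ℕ) : ℝ) ≤ |W n| / n :=
          div_le_div_of_nonneg_left (abs_nonneg _) hn0
            (by push_cast; linarith [Nat.cast_nonneg (α := ℝ) N₀])
      _ ≤ (|W m| + ∑ i ∈ Finset.range n, e' i) / n :=
          div_le_div_of_nonneg_right (hsum n hn) hn0.le
      _ = |W m| / n + (n : ℝ)⁻¹ * ∑ i ∈ Finset.range n, e' i := by ring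
  have hfin := (hWN.add hMN).add_const q
  rw [zero_add, zero_add] at hfin
  refine hfin.congr' ?_
  filter_upwards [hNinf.eventually_gt_atTop 0] with n hn
  simp only [hW]
  field_simp
  ring

/-! ### State counts and their drift in master-equation form. -/

/-- The number of nodes with `k` leaf neighbours and `l` non-leaf neighbours. -/
noncomputable def stateCount (k l : ℕ) {N : ℕ} (G : SimpleGraph (Fin N)) : ℝ :=
  stateSum (fun a b => if a = k ∧ b = l then 1 else 0) G

section StateCount

variable {N : ℕ} {G : SimpleGraph (Fin N)}

theorem stateFraction_eq (k l : ℕ) : stateFraction G k l = stateCount k l G / N := by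
  simp [stateFraction, stateCount, stateSum]

theorem stateFraction_nonneg (k l : ℕ) : 0 ≤ stateFraction G k l := by
  rw [stateFraction]
  positivity

theorem stateFraction_le_one (k l : ℕ) : stateFraction G k l ≤ 1 := by
  refine div_le_one_of_le₀ ?_ (Nat.cast_nonneg _)
  exact_mod_cast (Finset.card_filter_le _ _).trans (by simp)

theorem degreeFraction_eq_sum (x : ℕ) :
    degreeFraction G x
      = ∑ kl ∈ Finset.HasAntidiagonal.antidiagonal x, stateFraction G kl.1 kl.2 := by
  classical
  simp only [stateFraction_eq, ← Finset.sum_div, degreeFraction, stateCount, stateSum]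
  congr 1
  rw [Finset.sum_comm, Finset.card_filter]
  push_cast
  refine Finset.sum_congr rfl fun i _ => ?_
  have h := leafNeighbors_add_nonLeafNeighbors (G := G) i
  have h2 : ∀ kl : ℕ × ℕ, (leafNeighbors G i = kl.1 ∧ nonLeafNeighbors G i = kl.2)
      ↔ (leafNeighbors G i, nonLeafNeighbors G i) = kl := fun kl => by rw [Prod.ext_iff]
  simp only [h2, Finset.sum_ite_eq, Finset.HasAntidiagonal.mem_antidiagonal]
  convert rfl using 2
  rw [h]

theorem LeavesApart.leafCount_eq (ha : LeavesApart G) : leafCount G = stateCount 0 1 G := by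
  refine Finset.sum_congr rfl fun i _ => if_congr ⟨fun h => ?_, fun h => ?_⟩ rfl rfl
  · exact ⟨ha.leafNeighbors_eq_zero h, ha.nonLeafNeighbors_eq_one h⟩
  · have := leafNeighbors_add_nonLeafNeighbors (G := G) i
    omega

/-- Such a node would be a leaf attached to a leaf. -/
theorem LeavesApart.stateCount_one_zero (ha : LeavesApart G) : stateCount 1 0 G = 0 := by
  rw [stateCount, stateSum]
  refine Finset.sum_eq_zero fun i _ => if_neg fun h => ?_
  have h1 := leafNeighbors_add_nonLeafNeighbors (G := G) i
  have := ha.leafNeighbors_eq_zero (v := i) (by omega)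
  omega

theorem stateSum_transition (k l : ℕ) :
    stateSum (fun a b => (a : ℝ) * ((if a + 1 = k ∧ b = l then 1 else 0)
        + (if a - 1 = k ∧ b + 1 = l then 1 else 0) - 2 * if a = k ∧ b = l then 1 else 0)) G
      = (if k = 0 then 0 else ((k : ℝ) - 1) * stateCount (k - 1) l G)
        + (if l = 0 then 0 else ((k : ℝ) + 1) * stateCount (k + 1) (l - 1) G)
        - 2 * k * stateCount k l G := by
  have h1 : ∀ a b : ℕ, (a : ℝ) * (if a + 1 = k ∧ b = l then 1 else 0)
      = if k = 0 then 0 else ((k : ℝ) - 1) * if a = k - 1 ∧ b = l then 1 else 0 := by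
    intro a b
    rcases k with _ | k
    · simp
    · by_cases h : a = k ∧ b = l
      · simp [h]
      · simp [h]
  have h2 : ∀ a b : ℕ, (a : ℝ) * (if a - 1 = k ∧ b + 1 = l then 1 else 0)
      = if l = 0 then 0 else ((k : ℝ) + 1) * if a = k + 1 ∧ b = l - 1 then 1 else 0 := by
    intro a b
    rcases l with _ | l
    · simp
    -- At `a = 0` the truncated `a - 1` is harmless, as the factor `a` vanishes.
    rcases a with _ | a
    · simp
    · by_cases h : a = k ∧ b = l
      · simp [h]
      · simp [h]
  have h3 : ∀ a b : ℕ, (a : ℝ) * (if a = k ∧ b = l then 1 else 0)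
      = k * if a = k ∧ b = l then 1 else 0 := by
    intro a b
    split_ifs with h
    · rw [h.1]
    · simp
  have h4 : ∀ a b : ℕ, (a : ℝ) * ((if a + 1 = k ∧ b = l then 1 else 0)
        + (if a - 1 = k ∧ b + 1 = l then 1 else 0) - 2 * if a = k ∧ b = l then 1 else 0)
      = (if k = 0 then 0 else ((k : ℝ) - 1) * if a = k - 1 ∧ b = l then 1 else 0)
        + (if l = 0 then 0 else ((k : ℝ) + 1) * if a = k + 1 ∧ b = l - 1 then 1 else 0)
        - 2 * k * if a = k ∧ b = l then 1 else 0 := by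
    intro a b
    rw [← h1, ← h2, mul_assoc 2, ← h3]
    ring
  simp only [h4, stateCount, stateSum, Finset.sum_sub_distrib, Finset.sum_add_distrib,
    Finset.mul_sum]
  congr 2
  · split_ifs <;> simp
  · split_ifs <;> simp

theorem drift_stateCount (k l : ℕ) (h : HasLeaf G) (ha : LeavesApart G) :
    drift (qpaProb ⊥) (stateCount k l) G = masterSource k l
      + ((if k = 0 then 0 else ((k : ℝ) - 1) * stateCount (k - 1) l G)
        + (if l = 0 then 0 else ((k : ℝ) + 1) * stateCount (k + 1) (l - 1) G)
        - 2 * k * stateCount k l G) / (2 * leafCount G) := by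
  rw [← stateSum_transition]
  have := drift_stateSum (fun a b => if a = k ∧ b = l then 1 else 0) h ha
  refine this.trans ?_
  congr 1
  unfold masterSource
  by_cases hl : 1 = l
  · subst hl
    rcases k with _ | _ | k <;> simp
  · simp [hl, Ne.symm hl]

open scoped Classical in
theorem abs_stateCount_addNode_sub_le (k l : ℕ) {v : Fin N} (hv : 1 ≤ G.degree v) :
    |stateCount k l (addNode G v) - stateCount k l G| ≤ 3 :=
  abs_stateSum_addNode_sub_le (fun _ _ => by split_ifs <;> norm_num)
    (fun _ _ => by split_ifs <;> norm_num) hv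

theorem abs_drift_stateCount_le (k l : ℕ) (h : HasLeaf G) :
    |drift (qpaProb ⊥) (stateCount k l) G| ≤ 3 := by
  calc _ ≤ ∑ x, qpaProb ⊥ G x * 3 := by
        refine (Finset.abs_sum_le_sum_abs _ _).trans (Finset.sum_le_sum fun x _ => ?_)
        change |qpaProb ⊥ G x * _| ≤ _
        rw [abs_mul, abs_of_nonneg (h.qpaProb_bot_nonneg x)]
        exact mul_le_mul_of_nonneg_left (abs_stateCount_addNode_sub_le k l (h.1 x))
          (h.qpaProb_bot_nonneg x)
    _ = 3 := by rw [← Finset.sum_mul, h.sum_qpaProb_bot, one_mul]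

end StateCount

/-! ### Convergence along a path with sublinear noise. -/

section Convergence

variable {N₀ : ℕ} {G₀ : SimpleGraph (Fin N₀)}

theorem abs_noiseStep_stateCount_le (k l : ℕ) (h : HasLeaf G₀) (n : ℕ)
    (w : (i : ℕ) → Fin (N₀ + i)) :
    |noiseStep (qpaProb ⊥) (stateCount k l) G₀ n w| ≤ 6 := by
  have hn := hasLeaf_network w h n
  have h1 := abs_stateCount_addNode_sub_le k l (hn.1 (w n))
  have h2 := abs_drift_stateCount_le k l hn
  refine (abs_sub _ _).trans ?_
  have h3 : |stateCount k l (network G₀ w (n + 1)) - stateCount k l (network G₀ w n)| ≤ 3 := h1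
  linarith

/-- The initial tree may be a single edge, whose ends are adjacent leaves; one arrival removes this
exception. -/
theorem leavesApart_network (hG : G₀.Connected) (hN : 2 ≤ N₀) (w : (i : ℕ) → Fin (N₀ + i)) {n : ℕ}
    (hn : 1 ≤ n) : LeavesApart (network G₀ w n) :=
  (connected_network w hG n).leavesApart (by omega)

variable {w : (i : ℕ) → Fin (N₀ + i)}

theorem stateCount_network_succ (k l n : ℕ) :
    stateCount k l (network G₀ w (n + 1)) = stateCount k l (network G₀ w n)
      + drift (qpaProb ⊥) (stateCount k l) (network G₀ w n)
      + (noise (qpaProb ⊥) (stateCount k l) G₀ (n + 1) w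
        - noise (qpaProb ⊥) (stateCount k l) G₀ n w) := by
  rw [noise_succ, noiseStep]
  ring

/-- From the first arrival on, the drift of the leaf count is exactly 1/2, the only inflow being
from the empty state (1,0). -/
theorem tendsto_leafCount_div (hG : G₀.Connected) (hl : HasLeaf G₀) (hN : 2 ≤ N₀)
    (hM : Tendsto (fun n : ℕ => noise (qpaProb ⊥) (stateCount 0 1) G₀ n w / n) atTop (𝓝 0)) :
    Tendsto (fun n : ℕ => leafCount (network G₀ w n) / ((N₀ + n : ℕ) : ℝ)) atTop (𝓝 (1 / 2)) := by
  have h := tendsto_div_of_recursion (N₀ := N₀) (c := 0) (s := 1 / 2) le_rfl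
    (X := fun n => stateCount 0 1 (network G₀ w n)) (e := fun _ => 0) hM tendsto_const_nhds
    fun n hn => by
      have ha := leavesApart_network hG hN w hn
      rw [stateCount_network_succ, drift_stateCount 0 1 (hasLeaf_network w hl n) ha]
      simp [ha.stateCount_one_zero, masterSource]
  rw [add_zero, div_one] at h
  refine h.congr' ?_
  filter_upwards [eventually_ge_atTop 1] with n hn
  rw [(leavesApart_network hG hN w hn).leafCount_eq]

/-- Along a path whose noise is sublinear, the state fractions converge to the solution of the
master recurrence. -/
theorem tendsto_stateFraction {q : ℕ → ℕ → ℝ} (hq : IsMasterSolution q) (hG : G₀.Connected)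
    (hl : HasLeaf G₀) (hN : 2 ≤ N₀)
    (hM : ∀ k l, Tendsto (fun n : ℕ => noise (qpaProb ⊥) (stateCount k l) G₀ n w / n) atTop (𝓝 0))
    (k l : ℕ) :
    Tendsto (fun n : ℕ => stateFraction (network G₀ w n) k l) atTop (𝓝 (q k l)) := by
  have hL := tendsto_leafCount_div hG hl hN (hM 0 1)
  have hR : Tendsto (fun n : ℕ => ((N₀ + n : ℕ) : ℝ) / (2 * leafCount (network G₀ w n)) - 1) atTop
      (𝓝 0) := by
    have := ((hL.const_mul 2).inv₀ (by norm_num)).sub_const 1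
    norm_num at this
    refine this.congr fun n => ?_
    push_cast
    field_simp
  -- One state at a time, given the limits of the two states that feed it; the premises are
  -- conditional so that those with a negative index drop out.
  have step : ∀ k l, (k ≠ 0 → Tendsto (fun n : ℕ => stateFraction (network G₀ w n) (k - 1) l) atTop
        (𝓝 (q (k - 1) l))) →
      (l ≠ 0 → Tendsto (fun n : ℕ => stateFraction (network G₀ w n) (k + 1) (l - 1)) atTop
        (𝓝 (q (k + 1) (l - 1)))) →
      Tendsto (fun n : ℕ => stateFraction (network G₀ w n) k l) atTop (𝓝 (q k l)) := by
    intro k l h1 h2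
    set f : ℕ → ℕ → ℕ → ℝ := fun k l n => stateFraction (network G₀ w n) k l with hf
    have hA : Tendsto (fun n => (if k = 0 then 0 else ((k : ℝ) - 1) * f (k - 1) l n)
        + (if l = 0 then 0 else ((k : ℝ) + 1) * f (k + 1) (l - 1) n)) atTop
        (𝓝 ((if k = 0 then 0 else ((k : ℝ) - 1) * q (k - 1) l)
        + (if l = 0 then 0 else ((k : ℝ) + 1) * q (k + 1) (l - 1)))) := by
      refine Tendsto.add ?_ ?_
      · split_ifs with hk
        · exact tendsto_const_nhds
        · exact (h1 hk).const_mul _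
      · split_ifs with hk
        · exact tendsto_const_nhds
        · exact (h2 hk).const_mul _
    set A : ℕ → ℝ := fun n => (if k = 0 then 0 else ((k : ℝ) - 1) * f (k - 1) l n)
        + (if l = 0 then 0 else ((k : ℝ) + 1) * f (k + 1) (l - 1) n) with hAdef
    set a : ℝ := (if k = 0 then 0 else ((k : ℝ) - 1) * q (k - 1) l)
        + (if l = 0 then 0 else ((k : ℝ) + 1) * q (k + 1) (l - 1)) with ha
    have hB : Tendsto (fun n => f k l n
        * (((N₀ + n : ℕ) : ℝ) / (2 * leafCount (network G₀ w n)) - 1)) atTop (𝓝 0) :=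
      bdd_le_mul_tendsto_zero (b := 0) (B := 1)
        (Eventually.of_forall fun n => stateFraction_nonneg k l)
        (Eventually.of_forall fun n => stateFraction_le_one k l) hR
    -- The error of replacing `2 * leafCount` by the number of nodes and the inflow `A n` by its
    -- limit `a`.
    have he : Tendsto (fun n => (A n * (((N₀ + n : ℕ) : ℝ) / (2 * leafCount (network G₀ w n)) - 1)
        + (A n - a)) - 2 * k * (f k l n
        * (((N₀ + n : ℕ) : ℝ) / (2 * leafCount (network G₀ w n)) - 1))) atTop (𝓝 0) := by
      have := ((hA.mul hR).add (hA.sub_const a)).sub (hB.const_mul (2 * (k : ℝ)))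
      simpa only [mul_zero, sub_self, add_zero] using this
    have hq' : q k l = (a + masterSource k l) / (1 + 2 * k) := by
      rw [eq_div_iff (by positivity), ha, ← hq.recurrence_source]
      ring
    rw [hq']
    have h := tendsto_div_of_recursion (N₀ := N₀) (c := 2 * k) (s := a + masterSource k l)
      (by positivity) (X := fun n => stateCount k l (network G₀ w n)) (hM k l) he
      fun n hn => by
        have hN0 : ((N₀ + n : ℕ) : ℝ) ≠ 0 := by
          have : N₀ + n ≠ 0 := by omega
          exact_mod_cast this
        have hL0 := (hasLeaf_network w hl n).leafCount_pos.ne'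
        rw [stateCount_network_succ, drift_stateCount k l (hasLeaf_network w hl n)
          (leavesApart_network hG hN w hn)]
        have hA' : (if k = 0 then 0 else ((k : ℝ) - 1) * stateCount (k - 1) l (network G₀ w n))
            + (if l = 0 then 0 else ((k : ℝ) + 1) * stateCount (k + 1) (l - 1) (network G₀ w n))
            = A n * ((N₀ + n : ℕ) : ℝ) := by
          simp only [hAdef, hf, stateFraction_eq]
          split_ifs <;> field_simp <;> ring
        rw [hA']
        simp only [hf, stateFraction_eq]
        congr 2
        generalize ((N₀ + n : ℕ) : ℝ) = y at *
        field_simp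
        ring
    exact h.congr fun n => (stateFraction_eq k l).symm
  induction l generalizing k with
  | zero =>
    induction k with
    | zero => exact step 0 0 (fun h => absurd rfl h) fun h => absurd rfl h
    | succ k ih => exact step _ _ (fun _ => ih) fun h => absurd rfl h
  | succ l ihl =>
    induction k with
    | zero => exact step _ _ (fun h => absurd rfl h) fun _ => ihl _
    | succ k ih => exact step _ _ (fun _ => ih) fun _ => ihl _

end Convergence

/-! ### Equivalence of the processes and the conclusion. -/

theorem isQPA_bot_iff_isCR {Ω : Type*} [MeasurableSpace Ω] {μ : Measure Ω} {N₀ : ℕ}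
    {G₀ : SimpleGraph (Fin N₀)} {V : (i : ℕ) → Ω → Fin (N₀ + i)} (h : HasLeaf G₀) :
    IsQPA μ ⊥ G₀ V ↔ IsCR μ ⊥ (1 / 2) G₀ V := by
  refine and_congr_right fun _ => forall_congr' fun n => forall_congr' fun v => ?_
  dsimp only
  rw [(hasLeaf_network v h n).crProb_bot]

theorem IsQPA.ae_tendsto_stateFraction {Ω : Type*} [MeasurableSpace Ω] {μ : Measure Ω}
    [IsProbabilityMeasure μ] {N₀ : ℕ} {G₀ : SimpleGraph (Fin N₀)} {V : (i : ℕ) → Ω → Fin (N₀ + i)}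
    (hV : IsQPA μ ⊥ G₀ V) {q : ℕ → ℕ → ℝ} (hq : IsMasterSolution q) (hN : 2 ≤ N₀)
    (hG : G₀.IsTree) :
    ∀ᵐ ω ∂μ, ∀ k l : ℕ,
      Tendsto (fun n => stateFraction (network G₀ (fun i => V i ω) n) k l) atTop (𝓝 (q k l)) := by
  have hl := hG.hasLeaf hN
  have hM : ∀ᵐ ω ∂μ, ∀ k l : ℕ, Tendsto (fun n : ℕ =>
      noise (qpaProb ⊥) (stateCount k l) G₀ n (fun i => V i ω) / n) atTop (𝓝 0) :=
    ae_all_iff.2 fun k => ae_all_iff.2 fun l => FollowsRule.ae_tendsto_noise hV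
      (fun w n => (hasLeaf_network w hl n).sum_qpaProb_bot) (abs_noiseStep_stateCount_le k l hl)
  filter_upwards [hM] with ω hω k l
  exact tendsto_stateFraction hq hG.1 hl hN hω k l

theorem mainTheorem4 :
    -- `α = -∞` is the limit of both models as `α → -∞`, and there the two models are equivalent
    (∀ (N : ℕ) (G : SimpleGraph (Fin N)), 2 ≤ N → G.IsTree → ∀ i : Fin N,
      Tendsto (fun a : ℝ => qpaProb (a : WithBot ℝ) G i) atBot (𝓝 (qpaProb ⊥ G i)) ∧
      Tendsto (fun a : ℝ => crProb (a : WithBot ℝ) (1 / 2) G i) atBot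
        (𝓝 (crProb ⊥ (1 / 2) G i)) ∧
      qpaProb ⊥ G i = crProb ⊥ (1 / 2) G i) ∧
    -- the recurrence and the initial conditions determine the limiting fractions
    ∃ q : ℕ → ℕ → ℝ,
      IsMasterSolution q ∧ (∀ q' : ℕ → ℕ → ℝ, IsMasterSolution q' → q' = q) ∧
      HasSum (fun x : ℕ => ∑ kl ∈ Finset.HasAntidiagonal.antidiagonal x, q kl.1 kl.2) 1 ∧
      ∀ {Ω : Type*} [MeasurableSpace Ω] (μ : Measure Ω) [IsProbabilityMeasure μ]
        (N₀ : ℕ) (G₀ : SimpleGraph (Fin N₀)) (V : (i : ℕ) → Ω → Fin (N₀ + i)),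
        2 ≤ N₀ → G₀.IsTree →
        (IsQPA μ ⊥ G₀ V ↔ IsCR μ ⊥ (1 / 2) G₀ V) ∧
        (IsQPA μ ⊥ G₀ V →
          (∀ᵐ ω ∂μ, ∀ k l : ℕ,
            Tendsto (fun n => stateFraction (network G₀ (fun i => V i ω) n) k l) atTop
              (𝓝 (q k l))) ∧
          (∀ k l : ℕ,
            Tendsto (fun n => ∫ ω, stateFraction (network G₀ (fun i => V i ω) n) k l ∂μ) atTop
              (𝓝 (q k l))) ∧
          (∀ᵐ ω ∂μ, ∀ x : ℕ,
            Tendsto (fun n => degreeFraction (network G₀ (fun i => V i ω) n) x) atTop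
              (𝓝 (∑ kl ∈ Finset.HasAntidiagonal.antidiagonal x, q kl.1 kl.2)))) := by
  refine ⟨fun N G hN hG i => ?_, _, isMasterSolution_masterArray,
    fun q' hq' => isMasterSolution_masterArray.unique hq',
    isMasterSolution_masterArray.hasSum_antidiagonal, ?_⟩
  · have h := hG.hasLeaf hN
    exact ⟨tendsto_qpaProb h i, tendsto_crProb h i, (h.crProb_bot i).symm⟩
  · intro Ω _ μ _ N₀ G₀ V hN hG
    refine ⟨isQPA_bot_iff_isCR (hG.hasLeaf hN), fun hV => ?_⟩
    have hae := hV.ae_tendsto_stateFraction isMasterSolution_masterArray hN hG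
    refine ⟨hae, fun k l => ?_, ?_⟩
    · have hd : ∀ n, DependsOn (fun w : (i : ℕ) → Fin (N₀ + i) =>
          stateFraction (network G₀ w n) k l) (Set.Iio n) := fun n w w' hw => by
        dsimp only
        rw [network_congr hw]
      have := tendsto_integral_of_dominated_convergence (μ := μ) (fun _ => (1 : ℝ))
        (fun n => ((hd n).measurable_comp hV.1).aestronglyMeasurable) (integrable_const 1)
        (fun n => Eventually.of_forall fun ω => by
          rw [Real.norm_of_nonneg (stateFraction_nonneg k l)]
          exact stateFraction_le_one k l)
        (hae.mono fun ω hω => hω k l)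
      simpa using this
    · filter_upwards [hae] with ω hω x
      simp only [degreeFraction_eq_sum]
      exact tendsto_finsetSum _ fun kl _ => hω kl.1 kl.2
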